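/- Let $\|\cdot\|$ and $\langle\cdot,\cdot\rangle$ be the Euclidean norm and inner product on $\mathbb R^d$, and let $D$ be the closed unit ball. A Lévy measure on $\mathbb R^d$ is a positive Borel measure $\nu$ with $\nu(\{0\})=0$ and $\int_{\mathbb R^d}(1\wedge\|u\|^2)\,\nu(du)<\infty$. A random vector $X$ in $\mathbb R^d$ is infinitely divisible (ID) with triplet $(b,\Sigma,\nu)$, where $b\in\mathbb R^d$, $\Sigma$ is a symmetric positive semi-definite $d\times d$ matrix and $\nu$ is a Lévy measure, if for all $\xi\in\mathbb R^d$ $$\mathbb E\,e^{i\langle \xi,X\rangle}=\exp\Big(i\langle b,\xi\rangle-\tfrac12\langle\xi,\Sigma\xi\rangle+\int_{\mathbb R^d}\big(e^{i\langle\xi,u\rangle}-1-i\langle\xi,u\rangle\mathbf 1_D(u)\big)\,\nu(du)\Big).$$ It is called ID with Lévy measure $\nu$ and no Gaussian part if it is ID with triplet $(b,0,\nu)$ for some $b\in\mathbb R^d$. **Theorem.** Let $X=(X_1,\dots,X_d)$ be a random vector in $\mathbb R^d$ with $\mathbb E|X_i|<\infty$ for all $i\in\{1,\dots,d\}$, and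 let $\nu$ be a Lévy measure on $\mathbb R^d$ with $\int_{\|u\|\ge 1}\|u\|\,\nu(du)<\infty$. Then the identity in $\mathbb R^d$ $$\mathbb E[X f(X)]=\mathbb E[X]\,\mathbb E[f(X)]+\mathbb E\int_{\mathbb R^d}\big(f(X+u)-f(X)\big)\,u\,\nu(du)$$ holds for all bounded Lipschitz functions $f:\mathbb R^d\to\mathbb R$ if and only if $X$ is ID with Lévy measure $\nu$ and no Gaussian part. In that case the triplet of $X$ is $(b,0,\nu)$ with $b=\mathbb E X-\int_{\|u\|>1}u\,\nu(du)$. -/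

import Mathlib

open MeasureTheory Matrix
open scoped NNReal ENNReal

/-- A Lévy measure on `ℝᵈ`: a positive Borel measure `ν` with `ν {0} = 0` and
`∫ (1 ∧ ‖u‖²) ν(du) < ∞`. -/
structure IsLevyMeasure {d : ℕ} (ν : Measure (EuclideanSpace ℝ (Fin d))) : Prop where
  measure_zero : ν {0} = 0
  lintegral_lt_top : ∫⁻ u, ENNReal.ofReal (min 1 (‖u‖ ^ 2)) ∂ν < ∞

/-- The Lévy-Khintchine exponent with triplet `(b, S, ν)`, truncated at the closed unit ball:
`i⟨b, ξ⟩ - ⟨ξ, S ξ⟩ / 2 + ∫ (exp (i⟨ξ, u⟩) - 1 - i⟨ξ, u⟩ 1_{‖u‖ ≤ 1}) ν(du)`. -/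
noncomputable def levyKhintchineExponent {d : ℕ} (b : EuclideanSpace ℝ (Fin d))
    (S : Matrix (Fin d) (Fin d) ℝ) (ν : Measure (EuclideanSpace ℝ (Fin d)))
    (ξ : EuclideanSpace ℝ (Fin d)) : ℂ :=
  Complex.I * (inner ℝ b ξ : ℝ) - (1 / 2 : ℂ) * ((ξ.ofLp ⬝ᵥ (S *ᵥ ξ.ofLp) : ℝ) : ℂ)
    + ∫ u, (Complex.exp (Complex.I * (inner ℝ ξ u : ℝ)) - 1
        - (Metric.closedBall (0 : EuclideanSpace ℝ (Fin d)) 1).indicator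
            (fun v => Complex.I * ((inner ℝ ξ v : ℝ) : ℂ)) u) ∂ν

/-- The law `μ` on `ℝᵈ` is infinitely divisible with (generating) triplet `(b, S, ν)`: shift
vector `b`, Gaussian covariance `S`, Lévy measure `ν`. -/
structure IsIDWithTriplet {d : ℕ} (μ : Measure (EuclideanSpace ℝ (Fin d)))
    (b : EuclideanSpace ℝ (Fin d)) (S : Matrix (Fin d) (Fin d) ℝ)
    (ν : Measure (EuclideanSpace ℝ (Fin d))) : Prop where
  posSemidef : S.PosSemidef
  isLevyMeasure : IsLevyMeasure ν
  charFun_eq : ∀ ξ, charFun μ ξ = Complex.exp (levyKhintchineExponent b S ν ξ)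

/-! ### Test functions, the directional identity, and its stability under limits and Fourier
superposition -/

section SteinIdentity

open Filter Topology
open scoped RealInnerProductSpace

variable {E : Type*} [NormedAddCommGroup E] [InnerProductSpace ℝ E]

/-! For f(x) = exp(i⟨ξ,x⟩) the increment factors as f(x+u) - f(x) = exp(i⟨ξ,x⟩)(exp(i⟨ξ,u⟩) - 1).
With φ the characteristic function and m the mean, the identity in direction η becomes ∂_η φ(ξ) = i
φ(ξ) (⟨η,m⟩ + ∫ (exp(i⟨ξ,u⟩) - 1)⟨η,u⟩ ν(du)). The factor multiplying φ is the η-derivative of the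
Lévy-Khintchine exponent ψ with b = m - ∫_{‖u‖>1} u ν(du). So the identity on exponentials is the
equation ∂_η φ = φ ∂_η ψ.

If the identity holds for bounded Lipschitz f, it holds for the real and imaginary parts of
exponentials (`SteinIdentity.of_re_im`). Then φ exp(-ψ) is constant on lines through 0, and φ = exp
ψ (`charFun_eq_of_steinIdentity_exp`).

Conversely, differentiating φ = exp ψ gives the identity on exponentials, and the point ξ = 0
determines b. Fourier inversion and Fubini extend it to smooth compactly supported f; mollification,
cutoff and dominated convergence extend it to bounded Lipschitz f
(`SteinIdentity.of_isBoundedLipschitz`). All bounds in u use the weight min(1,‖u‖)‖u‖, which is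
ν-integrable by the Lévy condition and the first moment at infinity. -/

/-- A continuous function that is bounded, with increments controlled by `C * min 1 ‖u‖`. -/
structure IsBoundedLipschitz (C : ℝ) (f : E → ℂ) : Prop where
  continuous : Continuous f
  norm_le : ∀ x, ‖f x‖ ≤ C
  norm_sub_le : ∀ x u, ‖f (x + u) - f x‖ ≤ C * min 1 ‖u‖

theorem norm_ofReal_inner_le (x y : E) : ‖((⟪x, y⟫ : ℝ) : ℂ)‖ ≤ ‖x‖ * ‖y‖ := by
  rw [Complex.norm_real]; exact norm_inner_le_norm x y

theorem norm_exp_sub_one_le_min (ξ u : E) :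
    ‖Complex.exp (Complex.I * (⟪ξ, u⟫ : ℝ)) - 1‖ ≤ (2 + ‖ξ‖) * min 1 ‖u‖ := by
  have h2 : ‖Complex.exp (Complex.I * (⟪ξ, u⟫ : ℝ)) - 1‖ ≤ 2 := by
    refine (norm_sub_le _ _).trans ?_
    rw [Complex.norm_exp_I_mul_ofReal]; norm_num
  have h1 : ‖Complex.exp (Complex.I * (⟪ξ, u⟫ : ℝ)) - 1‖ ≤ ‖ξ‖ * ‖u‖ :=
    Real.norm_exp_I_mul_ofReal_sub_one_le.trans (norm_inner_le_norm ξ u)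
  have h3 := norm_nonneg ξ
  have h4 := norm_nonneg u
  rcases le_total 1 ‖u‖ with h | h
  · rw [min_eq_left h]; linarith
  · rw [min_eq_right h]; nlinarith

theorem isBoundedLipschitz_exp (ξ : E) :
    IsBoundedLipschitz (2 + ‖ξ‖) (fun x => Complex.exp (Complex.I * (⟪ξ, x⟫ : ℝ))) where
  continuous := by fun_prop
  norm_le x := by
    rw [Complex.norm_exp_I_mul_ofReal]; linarith [norm_nonneg ξ]
  norm_sub_le x u := by
    have : Complex.exp (Complex.I * (⟪ξ, x + u⟫ : ℝ)) - Complex.exp (Complex.I * (⟪ξ, x⟫ : ℝ))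
        = Complex.exp (Complex.I * (⟪ξ, x⟫ : ℝ)) * (Complex.exp (Complex.I * (⟪ξ, u⟫ : ℝ)) - 1) := by
      rw [inner_add_right, Complex.ofReal_add, mul_add, Complex.exp_add]; ring
    rw [this, norm_mul, Complex.norm_exp_I_mul_ofReal, one_mul]
    exact norm_exp_sub_one_le_min ξ u

/-- The covariance identity of the law `μ` with jump measure `ν` and mean `m`, tested against the
function `f` in the direction `η`. -/
def SteinIdentity [MeasurableSpace E] (μ ν : Measure E) (m η : E) (f : E → ℂ) : Prop :=
  ∫ x, (⟪η, x⟫ : ℂ) * f x ∂μ = (⟪η, m⟫ : ℂ) * ∫ x, f x ∂μ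
    + ∫ p : E × E, (f (p.1 + p.2) - f p.1) * (⟪η, p.2⟫ : ℂ) ∂(μ.prod ν)

namespace IsBoundedLipschitz

variable {C : ℝ} {f : E → ℂ}

theorem norm_increment_mul_le (hf : IsBoundedLipschitz C f) (η x u : E) :
    ‖(f (x + u) - f x) * (⟪η, u⟫ : ℂ)‖ ≤ C * ‖η‖ * (min 1 ‖u‖ * ‖u‖) := by
  rw [norm_mul]
  calc _ ≤ (C * min 1 ‖u‖) * (‖η‖ * ‖u‖) :=
        mul_le_mul (hf.norm_sub_le x u) (norm_ofReal_inner_le η u) (norm_nonneg _)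
          ((norm_nonneg _).trans (hf.norm_sub_le x u))
    _ = _ := by ring

variable [FiniteDimensional ℝ E] [MeasurableSpace E] [BorelSpace E]

theorem integrable_inner_mul (hf : IsBoundedLipschitz C f) {μ : Measure E}
    (hμ : Integrable (fun x => x) μ) (η : E) :
    Integrable (fun x => (⟪η, x⟫ : ℂ) * f x) μ := by
  refine (hμ.norm.const_mul (‖η‖ * C)).mono' (by have := hf.continuous; fun_prop)
    (ae_of_all _ fun x => ?_)
  rw [norm_mul]
  calc _ ≤ (‖η‖ * ‖x‖) * C :=
        mul_le_mul (norm_ofReal_inner_le η x) (hf.norm_le x) (norm_nonneg _) (by positivity)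
    _ = _ := by ring

theorem integrable_increment (hf : IsBoundedLipschitz C f) (μ ν : Measure E) [IsFiniteMeasure μ]
    [SFinite ν] (hν : Integrable (fun u => min 1 ‖u‖ * ‖u‖) ν) (η : E) :
    Integrable (fun p : E × E => (f (p.1 + p.2) - f p.1) * (⟪η, p.2⟫ : ℂ)) (μ.prod ν) := by
  refine ((hν.comp_snd μ).const_mul (C * ‖η‖)).mono' (by have := hf.continuous; fun_prop)
    (ae_of_all _ fun p => hf.norm_increment_mul_le η p.1 p.2)

end IsBoundedLipschitz

variable [FiniteDimensional ℝ E] [MeasurableSpace E] [BorelSpace E]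

variable {μ ν : Measure E} [IsProbabilityMeasure μ] [SFinite ν]

/-- The common constant C gives each of the three integrals a dominating function independent of n,
so pointwise convergence suffices. -/
theorem SteinIdentity.of_tendsto {m η : E} {C : ℝ} {f : E → ℂ} {F : ℕ → E → ℂ}
    (hμ : Integrable (fun x => x) μ) (hν : Integrable (fun u => min 1 ‖u‖ * ‖u‖) ν)
    (hF : ∀ n, IsBoundedLipschitz C (F n)) (h : ∀ n, SteinIdentity μ ν m η (F n))
    (hlim : ∀ x, Tendsto (fun n => F n x) atTop (𝓝 (f x))) : SteinIdentity μ ν m η f := by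
  unfold SteinIdentity at h ⊢
  have h1 : Tendsto (fun n => ∫ x, (⟪η, x⟫ : ℂ) * F n x ∂μ) atTop
      (𝓝 (∫ x, (⟪η, x⟫ : ℂ) * f x ∂μ)) := by
    refine tendsto_integral_of_dominated_convergence (fun x => ‖η‖ * C * ‖x‖)
      (fun n => ((hF n).integrable_inner_mul hμ η).aestronglyMeasurable)
      (hμ.norm.const_mul _) (fun n => ae_of_all _ fun x => ?_)
      (ae_of_all _ fun x => (hlim x).const_mul _)
    rw [norm_mul]
    calc _ ≤ (‖η‖ * ‖x‖) * C :=
          mul_le_mul (norm_ofReal_inner_le η x) ((hF n).norm_le x) (norm_nonneg _) (by positivity)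
      _ = _ := by ring
  have h2 : Tendsto (fun n => ∫ x, F n x ∂μ) atTop (𝓝 (∫ x, f x ∂μ)) :=
    tendsto_integral_of_dominated_convergence (fun _ => C)
      (fun n => (hF n).continuous.aestronglyMeasurable)
      (integrable_const _) (fun n => ae_of_all _ (hF n).norm_le) (ae_of_all _ hlim)
  have h3 : Tendsto (fun n => ∫ p : E × E, (F n (p.1 + p.2) - F n p.1) * (⟪η, p.2⟫ : ℂ) ∂(μ.prod ν))
      atTop (𝓝 (∫ p : E × E, (f (p.1 + p.2) - f p.1) * (⟪η, p.2⟫ : ℂ) ∂(μ.prod ν))) :=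
    tendsto_integral_of_dominated_convergence
      (fun p => C * ‖η‖ * (min 1 ‖p.2‖ * ‖p.2‖))
      (fun n => ((hF n).integrable_increment μ ν hν η).aestronglyMeasurable)
      ((hν.comp_snd μ).const_mul _)
      (fun n => ae_of_all _ fun p => (hF n).norm_increment_mul_le η p.1 p.2)
      (ae_of_all _ fun p => ((hlim _).sub (hlim _)).mul_const _)
  refine tendsto_nhds_unique h1 ?_
  simp_rw [h]
  exact (h2.const_mul _).add h3

/-- The identity is linear in the test function, so it can be integrated against g(ξ) dξ. The first
moment of g is needed for Fubini because the increment bound for an exponential grows like 2 + ‖ξ‖.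
-/
theorem SteinIdentity.integral_exp {m η : E} {g : E → ℂ}
    (hμ : Integrable (fun x => x) μ) (hν : Integrable (fun u => min 1 ‖u‖ * ‖u‖) ν)
    (hgc : Continuous g) (hg : Integrable g) (hg' : Integrable (fun ξ => ‖ξ‖ * ‖g ξ‖))
    (h : ∀ ξ, SteinIdentity μ ν m η (fun x => Complex.exp (Complex.I * (⟪ξ, x⟫ : ℝ)))) :
    SteinIdentity μ ν m η (fun x => ∫ ξ, g ξ * Complex.exp (Complex.I * (⟪ξ, x⟫ : ℝ))) := by
  have e1 : ∀ z : ℝ, ‖Complex.exp (Complex.I * z)‖ = 1 := Complex.norm_exp_I_mul_ofReal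
  have hgx : ∀ x, Integrable (fun ξ => g ξ * Complex.exp (Complex.I * (⟪ξ, x⟫ : ℝ))) := fun x => by
    refine hg.norm.mono' (by fun_prop) (ae_of_all _ fun ξ => ?_)
    rw [norm_mul, e1, mul_one]
  have i1 : Integrable (Function.uncurry fun (x : E) (ξ : E) =>
      (⟪η, x⟫ : ℂ) * (g ξ * Complex.exp (Complex.I * (⟪ξ, x⟫ : ℝ)))) (μ.prod volume) := by
    refine ((hμ.norm.mul_prod hg.norm).const_mul ‖η‖).mono' ?_ (ae_of_all _ fun p => ?_)
    · exact Continuous.aestronglyMeasurable (by unfold Function.uncurry; fun_prop)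
    · simp only [Function.uncurry, norm_mul, e1, mul_one]
      have := norm_ofReal_inner_le η p.1
      calc _ ≤ (‖η‖ * ‖p.1‖) * ‖g p.2‖ := by gcongr
        _ = _ := by ring
  have i2 : Integrable (Function.uncurry fun (x : E) (ξ : E) =>
      (g ξ * Complex.exp (Complex.I * (⟪ξ, x⟫ : ℝ)))) (μ.prod volume) := by
    refine (hg.norm.comp_snd μ).mono' ?_ (ae_of_all _ fun p => ?_)
    · exact Continuous.aestronglyMeasurable (by unfold Function.uncurry; fun_prop)
    · simp only [Function.uncurry, norm_mul, e1, mul_one]; exact le_rfl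
  have i3 : Integrable (Function.uncurry fun (p : E × E) (ξ : E) =>
      g ξ * ((Complex.exp (Complex.I * (⟪ξ, p.1 + p.2⟫ : ℝ))
        - Complex.exp (Complex.I * (⟪ξ, p.1⟫ : ℝ))) * (⟪η, p.2⟫ : ℂ)))
      ((μ.prod ν).prod volume) := by
    have hg2 : Integrable (fun ξ => 2 * ‖g ξ‖ + ‖ξ‖ * ‖g ξ‖) := (hg.norm.const_mul 2).add hg'
    refine (((hν.comp_snd μ).mul_prod hg2).const_mul ‖η‖).mono' ?_ (ae_of_all _ fun p => ?_)
    · exact Continuous.aestronglyMeasurable (by unfold Function.uncurry; fun_prop)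
    · simp only [Function.uncurry]
      rw [norm_mul]
      calc _ ≤ ‖g p.2‖ * ((2 + ‖p.2‖) * ‖η‖ * (min 1 ‖p.1.2‖ * ‖p.1.2‖)) := by
            gcongr; exact (isBoundedLipschitz_exp p.2).norm_increment_mul_le η p.1.1 p.1.2
        _ = _ := by ring
  unfold SteinIdentity at h ⊢
  beta_reduce at h ⊢
  calc ∫ x, (⟪η, x⟫ : ℂ) * (∫ ξ, g ξ * Complex.exp (Complex.I * (⟪ξ, x⟫ : ℝ))) ∂μ
      = ∫ x, (∫ ξ, (⟪η, x⟫ : ℂ) * (g ξ * Complex.exp (Complex.I * (⟪ξ, x⟫ : ℝ)))) ∂μ := by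
        simp_rw [integral_const_mul]
    _ = ∫ ξ, g ξ * ∫ x, (⟪η, x⟫ : ℂ) * Complex.exp (Complex.I * (⟪ξ, x⟫ : ℝ)) ∂μ := by
        rw [integral_integral_swap i1]
        refine integral_congr_ae (ae_of_all _ fun ξ => ?_)
        simp only
        rw [← integral_const_mul]
        congr 1; ext x; ring
    _ = ∫ ξ, ((⟪η, m⟫ : ℂ) * ∫ x, g ξ * Complex.exp (Complex.I * (⟪ξ, x⟫ : ℝ)) ∂μ)
        + ∫ p : E × E, g ξ * ((Complex.exp (Complex.I * (⟪ξ, p.1 + p.2⟫ : ℝ))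
          - Complex.exp (Complex.I * (⟪ξ, p.1⟫ : ℝ))) * (⟪η, p.2⟫ : ℂ)) ∂(μ.prod ν) := by
        refine integral_congr_ae (ae_of_all _ fun ξ => ?_)
        simp only [h ξ, integral_const_mul]
        ring
    _ = _ := by
        have j2 := i2.integral_prod_right
        have j3 := i3.integral_prod_right
        simp only [Function.uncurry] at j2 j3
        rw [integral_add (j2.const_mul _) j3,
          integral_const_mul, ← integral_integral_swap i2, ← integral_integral_swap i3]
        congr 1
        refine integral_congr_ae (ae_of_all _ fun p => ?_)
        simp only
        rw [← integral_sub (hgx _) (hgx _), ← integral_mul_const]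
        congr 1; ext ξ; ring

end SteinIdentity

/-! ### From exponentials to bounded Lipschitz functions: Fourier inversion, mollification, cutoff
-/

section Approximation

open Filter Topology
open scoped RealInnerProductSpace

open scoped ContDiff Convolution FourierTransform

variable {E : Type*} [NormedAddCommGroup E]

namespace IsBoundedLipschitz

variable {C : ℝ} {f : E → ℂ}

theorem nonneg (hf : IsBoundedLipschitz C f) : 0 ≤ C := (norm_nonneg _).trans (hf.norm_le 0)

/-- Multiplying by the cutoff function `max 0 (min 1 (r - ‖x‖))`. -/
theorem cutoff (hf : IsBoundedLipschitz C f) (r : ℝ) :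
    IsBoundedLipschitz (2 * C) (fun x => ((max 0 (min 1 (r - ‖x‖)) : ℝ) : ℂ) * f x) := by
  have hC := hf.nonneg
  have h0 : ∀ t : ℝ, |max 0 (min 1 t)| ≤ 1 := fun t => by
    rw [abs_of_nonneg (le_max_left _ _)]; exact max_le zero_le_one (min_le_left _ _)
  have hn : ∀ x : E, ‖((max 0 (min 1 (r - ‖x‖)) : ℝ) : ℂ)‖ ≤ 1 := fun x => by
    rw [Complex.norm_real]; exact h0 _
  have h1 : ∀ s t : ℝ, |max 0 (min 1 s) - max 0 (min 1 t)| ≤ min 1 |s - t| := fun s t => by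
    refine le_min ?_ ?_
    · have a1 : max 0 (min 1 s) ≤ 1 := max_le zero_le_one (min_le_left _ _)
      have a2 : max 0 (min 1 t) ≤ 1 := max_le zero_le_one (min_le_left _ _)
      have a3 : 0 ≤ max 0 (min 1 s) := le_max_left _ _
      have a4 : 0 ≤ max 0 (min 1 t) := le_max_left _ _
      rw [abs_le]; constructor <;> linarith
    · refine (abs_max_sub_max_le_max _ _ _ _).trans ?_
      rw [sub_self, abs_zero]
      refine max_le (abs_nonneg _) ((abs_min_sub_min_le_max _ _ _ _).trans ?_)
      rw [sub_self, abs_zero]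
      exact max_le (abs_nonneg _) le_rfl
  refine ⟨by have := hf.continuous; fun_prop, fun x => ?_, fun x u => ?_⟩
  · rw [norm_mul]
    calc _ ≤ 1 * C := mul_le_mul (hn x) (hf.norm_le x) (norm_nonneg _) zero_le_one
      _ ≤ 2 * C := by linarith
  · set a := max 0 (min 1 (r - ‖x + u‖))
    set b := max 0 (min 1 (r - ‖x‖))
    have hab : ‖((a - b : ℝ) : ℂ)‖ ≤ min 1 ‖u‖ := by
      rw [Complex.norm_real]
      refine (h1 _ _).trans (min_le_min le_rfl ?_)
      rw [sub_sub_sub_cancel_left]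
      refine (abs_norm_sub_norm_le _ _).trans (le_of_eq ?_)
      rw [← norm_neg]; congr 1; abel
    -- Discrete product rule: the increments of f and of the cutoff each contribute C min(1,‖u‖),
    -- hence the constant 2C.
    have : (a : ℂ) * f (x + u) - b * f x = a * (f (x + u) - f x) + ((a - b : ℝ) : ℂ) * f x := by
      push_cast; ring
    rw [this]
    calc _ ≤ ‖(a : ℂ)‖ * ‖f (x + u) - f x‖ + ‖((a - b : ℝ) : ℂ)‖ * ‖f x‖ := by
          rw [← norm_mul, ← norm_mul]; exact norm_add_le _ _
      _ ≤ 1 * (C * min 1 ‖u‖) + min 1 ‖u‖ * C := by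
          gcongr
          · exact hn _
          · exact hf.norm_sub_le x u
          · exact hf.norm_le x
      _ = _ := by ring

theorem of_lipschitzWith {f : E → ℝ} {M : ℝ} {K : ℝ≥0} (hM : ∀ x, |f x| ≤ M)
    (hK : LipschitzWith K f) : IsBoundedLipschitz (2 * M + K) (fun x => (f x : ℂ)) := by
  have hM0 : 0 ≤ M := (abs_nonneg _).trans (hM 0)
  refine ⟨by have := hK.continuous; fun_prop, fun x => ?_, fun x u => ?_⟩
  · rw [Complex.norm_real]
    exact (hM x).trans (by linarith [K.coe_nonneg])
  · rw [← Complex.ofReal_sub, Complex.norm_real]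
    have h1 : ‖f (x + u) - f x‖ ≤ 2 * M :=
      (_root_.norm_sub_le _ _).trans (by rw [two_mul]; exact add_le_add (hM _) (hM _))
    have h2 : ‖f (x + u) - f x‖ ≤ K * ‖u‖ := by
      simpa [dist_eq_norm] using hK.dist_le_mul (x + u) x
    have h3 := K.coe_nonneg
    have h4 := norm_nonneg u
    rcases le_total 1 ‖u‖ with h | h
    · rw [min_eq_left h]; linarith
    · rw [min_eq_right h]; nlinarith

theorem clm_comp (hf : IsBoundedLipschitz C f)
    (L : ℂ →L[ℝ] ℂ) (hL : ∀ z, ‖L z‖ ≤ ‖z‖) : IsBoundedLipschitz C (fun x => L (f x)) where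
  continuous := L.continuous.comp hf.continuous
  norm_le x := (hL _).trans (hf.norm_le x)
  norm_sub_le x u := by
    rw [← map_sub]; exact (hL _).trans (hf.norm_sub_le x u)

theorem re (hf : IsBoundedLipschitz C f) :
    IsBoundedLipschitz C (fun x => ((f x).re : ℂ)) :=
  hf.clm_comp (Complex.ofRealCLM.comp Complex.reCLM) fun z => by
    simpa using Complex.abs_re_le_norm z

theorem im (hf : IsBoundedLipschitz C f) :
    IsBoundedLipschitz C (fun x => ((f x).im : ℂ)) :=
  hf.clm_comp (Complex.ofRealCLM.comp Complex.imCLM) fun z => by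
    simpa using Complex.abs_im_le_norm z

theorem lipschitzWith {f : E → ℝ}
    (hf : IsBoundedLipschitz C (fun x => (f x : ℂ))) : LipschitzWith C.toNNReal f := by
  refine LipschitzWith.of_dist_le_mul fun x y => ?_
  have h := hf.norm_sub_le y (x - y)
  rw [add_sub_cancel, ← Complex.ofReal_sub, Complex.norm_real] at h
  rw [dist_eq_norm, dist_eq_norm, Real.coe_toNNReal _ hf.nonneg]
  exact h.trans (mul_le_mul_of_nonneg_left (min_le_right _ _) hf.nonneg)

variable [InnerProductSpace ℝ E] [FiniteDimensional ℝ E] [MeasurableSpace E] [BorelSpace E]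

/-- Convolution with a normed bump averages translates of f against a probability density, so the
constant C does not change with the bump. -/
theorem normed_convolution (hf : IsBoundedLipschitz C f) (φ : ContDiffBump (0 : E)) :
    IsBoundedLipschitz C (φ.normed volume ⋆[ContinuousLinearMap.lsmul ℝ ℝ, volume] f) := by
  have hi : ∀ h : E → ℂ, Continuous h →
      Integrable fun t => φ.normed volume t • h t := fun h hh =>
    (φ.continuous_normed.smul hh).integrable_of_hasCompactSupport
      (φ.hasCompactSupport_normed.smul_right)
  have hfc := hf.continuous
  have hb : ∀ (h : E → ℂ) (B : ℝ), Continuous h → (∀ t, ‖h t‖ ≤ B) →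
      ‖∫ t, φ.normed volume t • h t‖ ≤ B := fun h B hh hB => by
    calc _ ≤ ∫ t, φ.normed volume t * B := by
          refine norm_integral_le_of_norm_le (φ.integrable_normed.mul_const B) (ae_of_all _ fun t => ?_)
          rw [norm_smul, Real.norm_of_nonneg (φ.nonneg_normed t)]
          exact mul_le_mul_of_nonneg_left (hB t) (φ.nonneg_normed t)
      _ = B := by rw [integral_mul_const, φ.integral_normed, one_mul]
  refine ⟨?_, fun x => ?_, fun x u => ?_⟩
  · exact φ.hasCompactSupport_normed.continuous_convolution_left _ φ.continuous_normed
      hfc.locallyIntegrable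
  · simp only [convolution_def, ContinuousLinearMap.lsmul_apply]
    exact hb (fun t => f (x - t)) C (by fun_prop) fun t => hf.norm_le _
  · simp only [convolution_def, ContinuousLinearMap.lsmul_apply]
    rw [← integral_sub (hi (fun t => f (x + u - t)) (by fun_prop))
      (hi (fun t => f (x - t)) (by fun_prop))]
    simp_rw [← smul_sub]
    refine hb (fun t => f (x + u - t) - f (x - t)) _ (by fun_prop) fun t => ?_
    rw [add_sub_right_comm]
    exact hf.norm_sub_le _ _

end IsBoundedLipschitz

variable [InnerProductSpace ℝ E] [FiniteDimensional ℝ E] [MeasurableSpace E] [BorelSpace E]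
variable {μ ν : Measure E} [IsProbabilityMeasure μ] [SFinite ν]

theorem SteinIdentity.of_contDiff_hasCompactSupport {m η : E} {f : E → ℂ}
    (hμ : Integrable (fun x => x) μ) (hν : Integrable (fun u => min 1 ‖u‖ * ‖u‖) ν)
    (hf : ContDiff ℝ ∞ f) (hfs : HasCompactSupport f)
    (h : ∀ ξ, SteinIdentity μ ν m η (fun x => Complex.exp (Complex.I * (⟪ξ, x⟫ : ℝ)))) :
    SteinIdentity μ ν m η f := by
  let F : SchwartzMap E ℂ := hfs.toSchwartzMap hf
  let G : SchwartzMap E ℂ := 𝓕 F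
  -- The phase in `𝓕` is 2π⟨v,x⟩; the substitution v = cξ removes the 2π and produces the Jacobian c
  -- ^ dim E.
  let c : ℝ := (2 * Real.pi)⁻¹
  have hc : 0 < c := by positivity
  have hG0 : Integrable (fun ξ => G ξ) := G.integrable
  have hG1 : Integrable (fun ξ => ‖ξ‖ * ‖G ξ‖) := by
    simpa using G.integrable_pow_mul volume 1
  have hG2 : Integrable (fun ξ => ‖c • ξ‖ * ‖G (c • ξ)‖) :=
    (integrable_comp_smul_iff volume (fun ξ => ‖ξ‖ * ‖G ξ‖) hc.ne').2 hG1
  have key : f = fun x => ∫ ξ, ((c ^ Module.finrank ℝ E : ℝ) * G (c • ξ))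
      * Complex.exp (Complex.I * (⟪ξ, x⟫ : ℝ)) := by
    ext x
    have e1 : f x = ∫ v, Complex.exp ((↑(2 * Real.pi * ⟪v, x⟫) * Complex.I)) • G v := by
      rw [← Real.fourierInv_eq']
      have : 𝓕⁻ (𝓕 F) = F := FourierTransform.fourierInv_fourier_eq F
      calc f x = F x := rfl
        _ = (𝓕⁻ (𝓕 F)) x := by rw [this]
        _ = _ := by rw [SchwartzMap.fourierInv_coe]
    have e2 := Measure.integral_comp_smul volume
      (fun v => Complex.exp ((↑(2 * Real.pi * ⟪v, x⟫) * Complex.I)) • G v) c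
    rw [← e1, abs_of_pos (by positivity)] at e2
    have e3 : f x = (c ^ Module.finrank ℝ E) • ((c ^ Module.finrank ℝ E)⁻¹ • f x) := by
      rw [smul_smul, mul_inv_cancel₀ (by positivity), one_smul]
    rw [e3, ← e2, ← integral_smul]
    congr 1; ext ξ
    rw [real_inner_smul_left, ← mul_assoc, mul_inv_cancel₀ (by positivity), one_mul, smul_eq_mul,
      Complex.real_smul, mul_comm (⟪ξ, x⟫ : ℂ)]
    ring
  rw [key]
  refine SteinIdentity.integral_exp hμ hν (by have := G.continuous; fun_prop) ?_ ?_ h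
  · exact ((integrable_comp_smul_iff volume (fun ξ => G ξ) hc.ne').2 hG0).const_mul _
  · refine (hG2.const_mul (c⁻¹ * c ^ Module.finrank ℝ E)).congr (ae_of_all _ fun ξ => ?_)
    simp only
    rw [norm_mul, norm_smul, Complex.norm_real, Real.norm_of_nonneg hc.le,
      Real.norm_of_nonneg (by positivity)]
    field_simp

theorem SteinIdentity.of_isBoundedLipschitz {m η : E} {C : ℝ} {f : E → ℂ}
    (hμ : Integrable (fun x => x) μ) (hν : Integrable (fun u => min 1 ‖u‖ * ‖u‖) ν)
    (hf : IsBoundedLipschitz C f)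
    (h : ∀ ξ, SteinIdentity μ ν m η (fun x => Complex.exp (Complex.I * (⟪ξ, x⟫ : ℝ)))) :
    SteinIdentity μ ν m η f := by
  have hcut : ∀ n : ℕ, SteinIdentity μ ν m η
      (fun x => ((max 0 (min 1 ((n : ℝ) - ‖x‖)) : ℝ) : ℂ) * f x) := fun n => by
    have hg := hf.cutoff n
    have hgs : HasCompactSupport (fun x => ((max 0 (min 1 ((n : ℝ) - ‖x‖)) : ℝ) : ℂ) * f x) := by
      refine HasCompactSupport.intro (isCompact_closedBall (0 : E) n) fun x hx => ?_
      rw [mem_closedBall_zero_iff, not_le] at hx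
      rw [max_eq_left ((min_le_right _ _).trans (by linarith)), Complex.ofReal_zero, zero_mul]
    let φ : ℕ → ContDiffBump (0 : E) := fun k =>
      ⟨1 / ((k : ℝ) + 1) / 2, 1 / ((k : ℝ) + 1), by positivity, half_lt_self (by positivity)⟩
    refine SteinIdentity.of_tendsto hμ hν (fun k => hg.normed_convolution (φ k)) (fun k => ?_)
      fun x => ContDiffBump.convolution_tendsto_right_of_continuous
        tendsto_one_div_add_atTop_nhds_zero_nat hg.continuous x
    refine SteinIdentity.of_contDiff_hasCompactSupport hμ hν ?_ ?_ h
    · exact (φ k).hasCompactSupport_normed.contDiff_convolution_left _ (φ k).contDiff_normed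
        hg.continuous.locallyIntegrable
    · exact (φ k).hasCompactSupport_normed.convolution _ hgs
  refine SteinIdentity.of_tendsto hμ hν (fun n => hf.cutoff (n : ℝ)) hcut fun x => ?_
  refine tendsto_const_nhds.congr' ?_
  -- Once n ≥ 1 + ‖x‖ the cutoff equals 1 at x, so the sequence is eventually constant there.
  filter_upwards [eventually_ge_atTop ⌈1 + ‖x‖⌉₊] with n hn
  have : 1 + ‖x‖ ≤ n := (Nat.le_ceil _).trans (by exact_mod_cast hn)
  rw [min_eq_left (by linarith), max_eq_right zero_le_one, Complex.ofReal_one, one_mul]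

end Approximation

/-! ### Directional derivatives of the characteristic function and of the Lévy-Khintchine integral
-/

section Derivatives

open Filter Topology
open scoped RealInnerProductSpace

theorem measurableSet_one_lt_norm {E : Type*} [SeminormedAddCommGroup E] [MeasurableSpace E]
    [OpensMeasurableSpace E] : MeasurableSet {u : E | 1 < ‖u‖} :=
  (isOpen_lt continuous_const continuous_norm).measurableSet

variable {E : Type*} [NormedAddCommGroup E] [InnerProductSpace ℝ E]

theorem hasDerivAt_exp_inner (ξ η x : E) (t : ℝ) :
    HasDerivAt (fun t : ℝ => Complex.exp (Complex.I * (⟪ξ + t • η, x⟫ : ℝ)))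
      (Complex.I * ((⟪η, x⟫ : ℂ) * Complex.exp (Complex.I * (⟪ξ + t • η, x⟫ : ℝ)))) t := by
  have h1 : HasDerivAt (fun t : ℝ => ⟪ξ + t • η, x⟫) ⟪η, x⟫ t := by
    simp only [inner_add_left, real_inner_smul_left]
    simpa using ((hasDerivAt_id t).mul_const ⟪η, x⟫).const_add ⟪ξ, x⟫
  have h2 := (h1.ofReal_comp.const_mul Complex.I).cexp
  refine h2.congr_deriv ?_
  ring

theorem norm_exp_I_mul_sub_one_sub_le (y : ℝ) :
    ‖Complex.exp (Complex.I * y) - 1 - Complex.I * y‖ ≤ 3 * y ^ 2 := by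
  have hn : ‖Complex.I * (y : ℂ)‖ = |y| := by
    rw [norm_mul, Complex.norm_I, one_mul, Complex.norm_real, Real.norm_eq_abs]
  rcases le_total |y| 1 with h | h
  · refine (Complex.norm_exp_sub_one_sub_id_le (hn.trans_le h)).trans ?_
    rw [hn, sq_abs]
    linarith [sq_nonneg y]
  · have h1 : ‖Complex.exp (Complex.I * y) - 1 - Complex.I * y‖ ≤ 1 + 1 + |y| := by
      refine (norm_sub_le _ _).trans ?_
      rw [hn]
      gcongr
      refine (norm_sub_le _ _).trans ?_
      rw [Complex.norm_exp_I_mul_ofReal, norm_one]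
    rw [← sq_abs]
    nlinarith

/-- The integrand of the Lévy-Khintchine formula truncated at the closed unit ball. -/
noncomputable def compensatedExp (ξ u : E) : ℂ :=
  Complex.exp (Complex.I * (⟪ξ, u⟫ : ℝ)) - 1
    - (Metric.closedBall (0 : E) 1).indicator (fun v => Complex.I * ((⟪ξ, v⟫ : ℝ) : ℂ)) u

theorem compensatedExp_of_le {u : E} (ξ : E) (hu : ‖u‖ ≤ 1) :
    compensatedExp ξ u
      = Complex.exp (Complex.I * (⟪ξ, u⟫ : ℝ)) - 1 - Complex.I * (⟪ξ, u⟫ : ℝ) := by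
  rw [compensatedExp, Set.indicator_of_mem (by simpa using hu)]

theorem compensatedExp_of_lt {u : E} (ξ : E) (hu : 1 < ‖u‖) :
    compensatedExp ξ u = Complex.exp (Complex.I * (⟪ξ, u⟫ : ℝ)) - 1 := by
  rw [compensatedExp, Set.indicator_of_notMem (by simpa using hu), sub_zero]

theorem norm_compensatedExp_le (ξ u : E) :
    ‖compensatedExp ξ u‖ ≤ (2 + 3 * ‖ξ‖ ^ 2) * (min 1 ‖u‖ * ‖u‖) := by
  have h0 := norm_nonneg u
  have h0' := norm_nonneg ξ
  rcases le_or_gt ‖u‖ 1 with h | h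
  · rw [compensatedExp_of_le ξ h, min_eq_right h]
    refine (norm_exp_I_mul_sub_one_sub_le _).trans ?_
    have h1 : |⟪ξ, u⟫| ≤ ‖ξ‖ * ‖u‖ := abs_real_inner_le_norm ξ u
    have h2 : ⟪ξ, u⟫ ^ 2 ≤ (‖ξ‖ * ‖u‖) ^ 2 := by
      rw [← sq_abs]; gcongr
    nlinarith [sq_nonneg ‖u‖]
  · rw [compensatedExp_of_lt ξ h, min_eq_left h.le]
    have h1 : ‖Complex.exp (Complex.I * (⟪ξ, u⟫ : ℝ)) - 1‖ ≤ 1 + 1 := by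
      refine (norm_sub_le _ _).trans ?_
      rw [Complex.norm_exp_I_mul_ofReal, norm_one]
    nlinarith [sq_nonneg ‖ξ‖]

/-- The derivative is split so that the first term is the jump integrand of the identity, while the
indicator integrates to the drift correction ∫_{‖u‖>1} u ν(du). -/
theorem hasDerivAt_compensatedExp (ξ η u : E) (t : ℝ) :
    HasDerivAt (fun t : ℝ => compensatedExp (ξ + t • η) u)
      (Complex.I * ((Complex.exp (Complex.I * (⟪ξ + t • η, u⟫ : ℝ)) - 1) * (⟪η, u⟫ : ℂ)
        + {v : E | 1 < ‖v‖}.indicator (fun v => ((⟪η, v⟫ : ℝ) : ℂ)) u)) t := by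
  have h1 := (hasDerivAt_exp_inner ξ η u t).sub_const 1
  rcases le_or_gt ‖u‖ 1 with h | h
  · simp only [compensatedExp_of_le _ h]
    rw [Set.indicator_of_notMem (by simpa using h)]
    have h2 : HasDerivAt (fun t : ℝ => ⟪ξ + t • η, u⟫) ⟪η, u⟫ t := by
      simp only [inner_add_left, real_inner_smul_left]
      simpa using ((hasDerivAt_id t).mul_const ⟪η, u⟫).const_add ⟪ξ, u⟫
    refine (h1.sub (h2.ofReal_comp.const_mul Complex.I)).congr_deriv ?_
    ring
  · simp only [compensatedExp_of_lt _ h]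
    rw [Set.indicator_of_mem (by simpa using h)]
    refine h1.congr_deriv ?_
    ring

theorem charFun_eq_integral_exp [MeasurableSpace E] (μ : Measure E) (ξ : E) :
    charFun μ ξ = ∫ x, Complex.exp (Complex.I * (⟪ξ, x⟫ : ℝ)) ∂μ := by
  rw [charFun_apply]
  congr 1; ext x
  rw [mul_comm, real_inner_comm]

variable [MeasurableSpace E] [BorelSpace E]

theorem measurable_compensatedExp (ξ : E) : Measurable (compensatedExp ξ) := by
  unfold compensatedExp
  refine Measurable.sub (Continuous.measurable (by fun_prop)) (Measurable.indicator
    (Continuous.measurable (by fun_prop)) Metric.isClosed_closedBall.measurableSet)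

theorem integrable_exp_inner (μ : Measure E) [IsFiniteMeasure μ] (ξ : E) :
    Integrable (fun x => Complex.exp (Complex.I * (⟪ξ, x⟫ : ℝ))) μ :=
  Integrable.of_bound (Continuous.aestronglyMeasurable (by fun_prop)) 1
    (ae_of_all _ fun x => (Complex.norm_exp_I_mul_ofReal _).le)

theorem integrable_exp_sub_one_mul {ν : Measure E}
    (hν : Integrable (fun u => min 1 ‖u‖ * ‖u‖) ν) (ξ η : E) :
    Integrable (fun u => (Complex.exp (Complex.I * (⟪ξ, u⟫ : ℝ)) - 1) * (⟪η, u⟫ : ℂ)) ν := by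
  refine (hν.const_mul ((2 + ‖ξ‖) * ‖η‖)).mono'
    (Continuous.aestronglyMeasurable (by fun_prop)) (ae_of_all _ fun u => ?_)
  simpa using (isBoundedLipschitz_exp ξ).norm_increment_mul_le η 0 u

theorem hasDerivAt_charFun_line {μ : Measure E} [IsFiniteMeasure μ]
    (hμ : Integrable (fun x => x) μ) (ξ η : E) (t : ℝ) :
    HasDerivAt (fun t : ℝ => charFun μ (ξ + t • η))
      (Complex.I * ∫ x, (⟪η, x⟫ : ℂ) * Complex.exp (Complex.I * (⟪ξ + t • η, x⟫ : ℝ)) ∂μ) t := by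
  simp only [charFun_eq_integral_exp]
  rw [← integral_const_mul]
  refine (hasDerivAt_integral_of_dominated_loc_of_deriv_le (bound := fun x => ‖η‖ * ‖x‖)
    Filter.univ_mem (Eventually.of_forall fun s => ?_) ?_ ?_ (ae_of_all _ fun x s _ => ?_)
    (hμ.norm.const_mul _) (ae_of_all _ fun x s _ => hasDerivAt_exp_inner ξ η x s)).2
  · exact Continuous.aestronglyMeasurable (by fun_prop)
  · exact integrable_exp_inner μ _
  · exact Continuous.aestronglyMeasurable (by fun_prop)
  · rw [norm_mul, norm_mul, Complex.norm_I, Complex.norm_exp_I_mul_ofReal, one_mul, mul_one]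
    exact norm_ofReal_inner_le η x

theorem integrable_compensatedExp {ν : Measure E}
    (hν : Integrable (fun u => min 1 ‖u‖ * ‖u‖) ν) (ξ : E) : Integrable (compensatedExp ξ) ν :=
  (hν.const_mul (2 + 3 * ‖ξ‖ ^ 2)).mono' (measurable_compensatedExp ξ).aestronglyMeasurable
    (ae_of_all _ fun u => norm_compensatedExp_le ξ u)

variable [FiniteDimensional ℝ E]

theorem integrableOn_one_lt_norm {ν : Measure E}
    (hν : Integrable (fun u => min 1 ‖u‖ * ‖u‖) ν) :
    IntegrableOn (fun u => u) {u : E | 1 < ‖u‖} ν := by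
  refine (hν.integrableOn (s := {u : E | 1 < ‖u‖})).mono'
    continuous_id.aestronglyMeasurable ?_
  refine (ae_restrict_iff' measurableSet_one_lt_norm).2 (ae_of_all _ fun u hu => ?_)
  rw [min_eq_left (le_of_lt hu), one_mul]

theorem integral_indicator_inner {ν : Measure E}
    (hν : Integrable (fun u => min 1 ‖u‖ * ‖u‖) ν) (η : E) :
    ∫ u, {v : E | 1 < ‖v‖}.indicator (fun v => ((⟪η, v⟫ : ℝ) : ℂ)) u ∂ν
      = ((⟪η, ∫ u in {u | 1 < ‖u‖}, u ∂ν⟫ : ℝ) : ℂ) := by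
  rw [integral_indicator measurableSet_one_lt_norm, integral_complex_ofReal,
    integral_inner (integrableOn_one_lt_norm hν)]

theorem hasDerivAt_integral_compensatedExp {ν : Measure E}
    (hν : Integrable (fun u => min 1 ‖u‖ * ‖u‖) ν) (ξ η : E) (t : ℝ) :
    HasDerivAt (fun t : ℝ => ∫ u, compensatedExp (ξ + t • η) u ∂ν)
      (Complex.I * (∫ u, (Complex.exp (Complex.I * (⟪ξ + t • η, u⟫ : ℝ)) - 1) * (⟪η, u⟫ : ℂ) ∂ν
        + ((⟪η, ∫ u in {u | 1 < ‖u‖}, u ∂ν⟫ : ℝ) : ℂ))) t := by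
  have hind : Integrable ({v : E | 1 < ‖v‖}.indicator (fun v => ((⟪η, v⟫ : ℝ) : ℂ))) ν :=
    (integrable_indicator_iff measurableSet_one_lt_norm).2
      ((integrableOn_one_lt_norm hν).const_inner η).ofReal
  rw [← integral_indicator_inner hν, ← integral_add (integrable_exp_sub_one_mul hν _ _) hind,
    ← integral_const_mul]
  refine (hasDerivAt_integral_of_dominated_loc_of_deriv_le
    -- For |s - t| < 1, ‖ξ + sη‖ ≤ ‖ξ‖ + (|t| + 1)‖η‖. The 3 is the 2 of the exponential bound plus
    -- 1 for the indicator term.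
    (bound := fun u => (3 + (‖ξ‖ + (|t| + 1) * ‖η‖)) * ‖η‖ * (min 1 ‖u‖ * ‖u‖))
    (Metric.ball_mem_nhds t one_pos)
    (Eventually.of_forall fun s => (measurable_compensatedExp _).aestronglyMeasurable)
    (integrable_compensatedExp hν _)
    (((integrable_exp_sub_one_mul hν _ _).add hind).const_mul _).aestronglyMeasurable
    (ae_of_all _ fun u s hs => ?_)
    (hν.const_mul _) (ae_of_all _ fun u s _ => hasDerivAt_compensatedExp ξ η u s)).2
  have hs' : |s| ≤ |t| + 1 := by
    rw [Metric.mem_ball, Real.dist_eq] at hs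
    linarith [abs_sub_abs_le_abs_sub s t]
  have h1 : ‖(Complex.exp (Complex.I * (⟪ξ + s • η, u⟫ : ℝ)) - 1) * (⟪η, u⟫ : ℂ)‖
      ≤ (2 + ‖ξ + s • η‖) * ‖η‖ * (min 1 ‖u‖ * ‖u‖) := by
    simpa using (isBoundedLipschitz_exp (ξ + s • η)).norm_increment_mul_le η 0 u
  have h2 : ‖{v : E | 1 < ‖v‖}.indicator (fun v => ((⟪η, v⟫ : ℝ) : ℂ)) u‖
      ≤ ‖η‖ * (min 1 ‖u‖ * ‖u‖) := by
    by_cases hu : 1 < ‖u‖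
    · rw [Set.indicator_of_mem (by simpa using hu), min_eq_left hu.le, one_mul]
      exact norm_ofReal_inner_le η u
    · rw [Set.indicator_of_notMem (by simpa using hu), norm_zero]
      positivity
  have h3 : ‖ξ + s • η‖ ≤ ‖ξ‖ + (|t| + 1) * ‖η‖ := by
    refine (norm_add_le _ _).trans ?_
    rw [norm_smul, Real.norm_eq_abs]
    gcongr
  rw [norm_mul, Complex.norm_I, one_mul]
  calc _ ≤ (2 + ‖ξ + s • η‖) * ‖η‖ * (min 1 ‖u‖ * ‖u‖) + ‖η‖ * (min 1 ‖u‖ * ‖u‖) :=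
        (norm_add_le _ _).trans (add_le_add h1 h2)
    _ ≤ (2 + (‖ξ‖ + (|t| + 1) * ‖η‖)) * ‖η‖ * (min 1 ‖u‖ * ‖u‖) + ‖η‖ * (min 1 ‖u‖ * ‖u‖) := by
        gcongr
    _ = _ := by ring

end Derivatives

/-! ### The identity on exponentials as a differential equation for the characteristic function -/

section Characterization

open Filter Topology
open scoped RealInnerProductSpace

variable {E : Type*} [NormedAddCommGroup E] [InnerProductSpace ℝ E] [FiniteDimensional ℝ E]
  [MeasurableSpace E]

theorem steinIdentity_exp_iff {μ ν : Measure E} [IsProbabilityMeasure μ] [SFinite ν] (m η ξ : E) :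
    SteinIdentity μ ν m η (fun x => Complex.exp (Complex.I * (⟪ξ, x⟫ : ℝ))) ↔
      ∫ x, (⟪η, x⟫ : ℂ) * Complex.exp (Complex.I * (⟪ξ, x⟫ : ℝ)) ∂μ
        = charFun μ ξ * (⟪η, m⟫
          + ∫ u, (Complex.exp (Complex.I * (⟪ξ, u⟫ : ℝ)) - 1) * (⟪η, u⟫ : ℂ) ∂ν) := by
  have h1 : ∫ p : E × E, (Complex.exp (Complex.I * (⟪ξ, p.1 + p.2⟫ : ℝ))
        - Complex.exp (Complex.I * (⟪ξ, p.1⟫ : ℝ))) * (⟪η, p.2⟫ : ℂ) ∂(μ.prod ν)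
      = charFun μ ξ * ∫ u, (Complex.exp (Complex.I * (⟪ξ, u⟫ : ℝ)) - 1) * (⟪η, u⟫ : ℂ) ∂ν := by
    rw [charFun_eq_integral_exp, ← integral_prod_mul]
    congr 1; ext p
    rw [inner_add_right, Complex.ofReal_add, mul_add, Complex.exp_add]
    ring
  rw [SteinIdentity, h1, ← charFun_eq_integral_exp, mul_add, mul_comm (charFun μ ξ) (⟪η, m⟫ : ℂ)]

variable [BorelSpace E]

/-- The Lévy-Khintchine exponent without Gaussian part, truncated at the closed unit ball. -/
noncomputable def purelyNonGaussianExponent (b : E) (ν : Measure E) (ξ : E) : ℂ :=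
  Complex.I * (⟪b, ξ⟫ : ℝ) + ∫ u, compensatedExp ξ u ∂ν

theorem hasDerivAt_purelyNonGaussianExponent_line {ν : Measure E}
    (hν : Integrable (fun u => min 1 ‖u‖ * ‖u‖) ν) (b ξ η : E) (t : ℝ) :
    HasDerivAt (fun t : ℝ => purelyNonGaussianExponent b ν (ξ + t • η))
      (Complex.I * ((⟪η, b + ∫ u in {u | 1 < ‖u‖}, u ∂ν⟫ : ℝ)
        + ∫ u, (Complex.exp (Complex.I * (⟪ξ + t • η, u⟫ : ℝ)) - 1) * (⟪η, u⟫ : ℂ) ∂ν)) t := by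
  have h2 : HasDerivAt (fun t : ℝ => ⟪b, ξ + t • η⟫) ⟪η, b⟫ t := by
    simp only [inner_add_right, real_inner_smul_right]
    simpa [real_inner_comm] using ((hasDerivAt_id t).mul_const ⟪b, η⟫).const_add ⟪b, ξ⟫
  refine ((h2.ofReal_comp.const_mul Complex.I).add
    (hasDerivAt_integral_compensatedExp hν ξ η t)).congr_deriv ?_
  rw [inner_add_right, Complex.ofReal_add]
  ring

theorem integral_inner_mul_exp_of_charFun_eq {μ ν : Measure E}
    [IsProbabilityMeasure μ] (hμ : Integrable (fun x => x) μ)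
    (hν : Integrable (fun u => min 1 ‖u‖ * ‖u‖) ν) {b : E}
    (h : ∀ ξ, charFun μ ξ = Complex.exp (purelyNonGaussianExponent b ν ξ)) (ξ η : E) :
    ∫ x, (⟪η, x⟫ : ℂ) * Complex.exp (Complex.I * (⟪ξ, x⟫ : ℝ)) ∂μ
      = charFun μ ξ * ((⟪η, b + ∫ u in {u | 1 < ‖u‖}, u ∂ν⟫ : ℝ)
        + ∫ u, (Complex.exp (Complex.I * (⟪ξ, u⟫ : ℝ)) - 1) * (⟪η, u⟫ : ℂ) ∂ν) := by
  have h1 := hasDerivAt_charFun_line hμ ξ η 0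
  have h2 := (hasDerivAt_purelyNonGaussianExponent_line hν b ξ η 0).cexp
  simp only [h] at h1
  have h3 := h1.unique h2
  simp only [zero_smul, add_zero, ← h] at h3
  refine mul_left_cancel₀ Complex.I_ne_zero (h3.trans ?_)
  ring

/-- At ξ = 0 the jump integrand vanishes and φ = 1, leaving only the drift. This also makes b
unique. -/
theorem integral_id_eq_of_charFun_eq {μ ν : Measure E} [IsProbabilityMeasure μ]
    (hμ : Integrable (fun x => x) μ)
    (hν : Integrable (fun u => min 1 ‖u‖ * ‖u‖) ν) {b : E}
    (h : ∀ ξ, charFun μ ξ = Complex.exp (purelyNonGaussianExponent b ν ξ)) :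
    ∫ x, x ∂μ = b + ∫ u in {u | 1 < ‖u‖}, u ∂ν := by
  refine ext_inner_left ℝ fun η => ?_
  have h1 := integral_inner_mul_exp_of_charFun_eq hμ hν h 0 η
  simp only [inner_zero_left, Complex.ofReal_zero, mul_zero, Complex.exp_zero, mul_one, sub_self,
    zero_mul, integral_zero, add_zero, charFun_zero, probReal_univ, Complex.ofReal_one,
    one_mul] at h1
  rw [integral_complex_ofReal, integral_inner hμ] at h1
  exact_mod_cast h1

variable {μ ν : Measure E} [IsProbabilityMeasure μ] [SFinite ν]

theorem steinIdentity_exp_of_charFun_eq (hμ : Integrable (fun x => x) μ)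
    (hν : Integrable (fun u => min 1 ‖u‖ * ‖u‖) ν) {b : E}
    (h : ∀ ξ, charFun μ ξ = Complex.exp (purelyNonGaussianExponent b ν ξ)) (ξ η : E) :
    SteinIdentity μ ν (∫ x, x ∂μ) η (fun x => Complex.exp (Complex.I * (⟪ξ, x⟫ : ℝ))) := by
  rw [steinIdentity_exp_iff, integral_id_eq_of_charFun_eq hμ hν h]
  exact integral_inner_mul_exp_of_charFun_eq hμ hν h ξ η

theorem charFun_eq_of_steinIdentity_exp (hμ : Integrable (fun x => x) μ)
    (hν : Integrable (fun u => min 1 ‖u‖ * ‖u‖) ν) {m : E}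
    (h : ∀ ξ η, SteinIdentity μ ν m η (fun x => Complex.exp (Complex.I * (⟪ξ, x⟫ : ℝ)))) (ξ : E) :
    charFun μ ξ
      = Complex.exp (purelyNonGaussianExponent (m - ∫ u in {u | 1 < ‖u‖}, u ∂ν) ν ξ) := by
  set b := m - ∫ u in {u | 1 < ‖u‖}, u ∂ν
  -- Working with φ exp(-ψ) along the line through 0 and ξ avoids taking a logarithm of φ, whose
  -- nonvanishing is not yet known.
  have hd : ∀ t : ℝ, HasDerivAt (fun t : ℝ => charFun μ (0 + t • ξ)
      * Complex.exp (-purelyNonGaussianExponent b ν (0 + t • ξ))) 0 t := fun t => by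
    have h1 := hasDerivAt_charFun_line hμ 0 ξ t
    have h2 := (hasDerivAt_purelyNonGaussianExponent_line hν b 0 ξ t).neg.cexp
    refine (h1.mul h2).congr_deriv ?_
    rw [(steinIdentity_exp_iff m ξ (0 + t • ξ)).1 (h _ _), sub_add_cancel]
    ring
  have h0 := is_const_of_deriv_eq_zero (fun t => (hd t).differentiableAt)
    (fun t => (hd t).deriv) 1 0
  have hz : purelyNonGaussianExponent b ν (0 : E) = 0 := by
    simp [purelyNonGaussianExponent, compensatedExp]
  simp only [one_smul, zero_smul, add_zero, zero_add, charFun_zero, hz, neg_zero, Complex.exp_zero,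
    probReal_univ, Complex.ofReal_one, mul_one] at h0
  rwa [Complex.exp_neg, mul_inv_eq_one₀ (Complex.exp_ne_zero _)] at h0

theorem SteinIdentity.of_re_im {m η : E} {C : ℝ} {f : E → ℂ}
    (hμ : Integrable (fun x => x) μ) (hν : Integrable (fun u => min 1 ‖u‖ * ‖u‖) ν)
    (hf : IsBoundedLipschitz C f)
    (hre : SteinIdentity μ ν m η (fun x => ((f x).re : ℂ)))
    (him : SteinIdentity μ ν m η (fun x => ((f x).im : ℂ))) : SteinIdentity μ ν m η f := by
  unfold SteinIdentity at *
  have a1 : ∫ x, (⟪η, x⟫ : ℂ) * f x ∂μ = (∫ x, (⟪η, x⟫ : ℂ) * ((f x).re : ℂ) ∂μ)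
      + Complex.I * ∫ x, (⟪η, x⟫ : ℂ) * ((f x).im : ℂ) ∂μ := by
    rw [← integral_const_mul, ← integral_add (hf.re.integrable_inner_mul hμ η)
      ((hf.im.integrable_inner_mul hμ η).const_mul _)]
    congr 1; ext x
    nth_rw 1 [← Complex.re_add_im (f x)]
    ring
  have a2 : ∫ x, f x ∂μ = (∫ x, ((f x).re : ℂ) ∂μ) + Complex.I * ∫ x, ((f x).im : ℂ) ∂μ := by
    have hi : ∀ {g : E → ℂ}, IsBoundedLipschitz C g → Integrable g μ := fun hg =>
      Integrable.of_bound hg.continuous.aestronglyMeasurable C (ae_of_all _ hg.norm_le)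
    rw [← integral_const_mul, ← integral_add (hi hf.re) ((hi hf.im).const_mul _)]
    congr 1; ext x
    nth_rw 1 [← Complex.re_add_im (f x)]
    ring
  have a3 : ∫ p : E × E, (f (p.1 + p.2) - f p.1) * (⟪η, p.2⟫ : ℂ) ∂(μ.prod ν)
      = (∫ p : E × E, (((f (p.1 + p.2)).re : ℂ) - (f p.1).re) * (⟪η, p.2⟫ : ℂ) ∂(μ.prod ν))
      + Complex.I *
        ∫ p : E × E, (((f (p.1 + p.2)).im : ℂ) - (f p.1).im) * (⟪η, p.2⟫ : ℂ) ∂(μ.prod ν) := by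
    rw [← integral_const_mul, ← integral_add (hf.re.integrable_increment μ ν hν η)
      ((hf.im.integrable_increment μ ν hν η).const_mul _)]
    congr 1; ext p
    nth_rw 1 [← Complex.re_add_im (f p.1), ← Complex.re_add_im (f (p.1 + p.2))]
    ring
  rw [a1, a2, a3, hre, him]
  ring

theorem IsBoundedLipschitz.integrable_increment_smul {C : ℝ} {f : E → ℝ}
    (hf : IsBoundedLipschitz C (fun x => (f x : ℂ)))
    (hν : Integrable (fun u => min 1 ‖u‖ * ‖u‖) ν) :
    Integrable (fun p : E × E => (f (p.1 + p.2) - f p.1) • p.2) (μ.prod ν) := by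
  refine ((hν.comp_snd μ).const_mul C).mono'
    (by have := hf.lipschitzWith.continuous; fun_prop) (ae_of_all _ fun p => ?_)
  have h := hf.norm_sub_le p.1 p.2
  rw [← Complex.ofReal_sub, Complex.norm_real] at h
  rw [norm_smul, ← mul_assoc]
  gcongr

/-- A vector equation is equivalent to its inner products with all η. Fubini turns the iterated
integral into the one over μ × ν. -/
theorem forall_steinIdentity_ofReal_iff {C : ℝ} {f : E → ℝ} (hμ : Integrable (fun x => x) μ)
    (hν : Integrable (fun u => min 1 ‖u‖ * ‖u‖) ν)
    (hf : IsBoundedLipschitz C (fun x => (f x : ℂ))) :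
    (∀ η, SteinIdentity μ ν (∫ x, x ∂μ) η (fun x => (f x : ℂ))) ↔
      ∫ x, f x • x ∂μ = (∫ x, f x ∂μ) • (∫ x, x ∂μ)
        + ∫ x, (∫ u, (f (x + u) - f x) • u ∂ν) ∂μ := by
  have hp := hf.integrable_increment_smul (μ := μ) hν
  have hx : Integrable (fun x => f x • x) μ := by
    refine (hμ.norm.const_mul C).mono'
      (by have := hf.lipschitzWith.continuous; fun_prop) (ae_of_all _ fun x => ?_)
    have h := hf.norm_le x
    rw [Complex.norm_real] at h
    rw [norm_smul]
    gcongr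
  rw [← integral_prod _ hp, ext_iff_inner_left ℝ]
  refine forall_congr' fun η => ?_
  rw [inner_add_right, real_inner_smul_right, ← integral_inner hx, ← integral_inner hp,
    SteinIdentity, ← Complex.ofReal_inj]
  simp only [real_inner_smul_right]
  push_cast [← integral_complex_ofReal]
  simp only [mul_comm]

end Characterization

/-! ### Consequences of the Lévy measure hypotheses -/

section Levy

variable {d : ℕ} {ν : Measure (EuclideanSpace ℝ (Fin d))}

/-- The density w = min(1,‖u‖²) turns ν into a finite measure; w ≠ 0 almost everywhere because ν has
no atom at 0, so ν is recovered through the density w⁻¹. Fubini relies on this. -/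
theorem IsLevyMeasure.sFinite (hν : IsLevyMeasure ν) : SFinite ν := by
  set w : EuclideanSpace ℝ (Fin d) → ℝ≥0∞ := fun u => ENNReal.ofReal (min 1 (‖u‖ ^ 2))
  have hw : Measurable w := by fun_prop
  have h0 : ∀ᵐ u ∂ν, w u ≠ 0 := by
    have : ∀ᵐ u ∂ν, u ∉ ({0} : Set (EuclideanSpace ℝ (Fin d))) :=
      measure_eq_zero_iff_ae_notMem.1 hν.measure_zero
    filter_upwards [this] with u hu
    have : 0 < ‖u‖ := norm_pos_iff.2 hu
    exact (ENNReal.ofReal_pos.2 (by positivity)).ne'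
  have : IsFiniteMeasure (ν.withDensity w) := isFiniteMeasure_withDensity hν.lintegral_lt_top.ne
  rw [← withDensity_inv_same hw h0 (ae_of_all _ fun _ => ENNReal.ofReal_ne_top)]
  infer_instance

/-- The weight is ‖u‖² inside the unit ball and ‖u‖ outside, so each hypothesis controls one region.
-/
theorem IsLevyMeasure.integrable_min_one_norm_mul_norm (hν : IsLevyMeasure ν)
    (hν1 : ∫⁻ u in {u | 1 ≤ ‖u‖}, ‖u‖ₑ ∂ν < ∞) :
    Integrable (fun u => min 1 ‖u‖ * ‖u‖) ν := by
  have hm : MeasurableSet {u : EuclideanSpace ℝ (Fin d) | 1 ≤ ‖u‖} :=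
    (isClosed_le continuous_const continuous_norm).measurableSet
  have h1 : Integrable (fun u : EuclideanSpace ℝ (Fin d) => min 1 (‖u‖ ^ 2)) ν := by
    refine ⟨Continuous.aestronglyMeasurable (by fun_prop), ?_⟩
    rw [hasFiniteIntegral_iff_ofReal (ae_of_all _ fun u => by positivity)]
    exact hν.lintegral_lt_top
  have h2 : Integrable ({u : EuclideanSpace ℝ (Fin d) | 1 ≤ ‖u‖}.indicator fun u => ‖u‖) ν := by
    rw [integrable_indicator_iff hm]
    refine ⟨Continuous.aestronglyMeasurable (by fun_prop), ?_⟩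
    simpa [HasFiniteIntegral] using hν1
  refine (h1.add h2).mono' (Continuous.aestronglyMeasurable (by fun_prop))
    (ae_of_all _ fun u => ?_)
  rw [Real.norm_of_nonneg (by positivity), Pi.add_apply]
  have hu := norm_nonneg u
  by_cases h : 1 ≤ ‖u‖
  · rw [min_eq_left h, one_mul, Set.indicator_of_mem (by simpa using h)]
    linarith [show 0 ≤ min 1 (‖u‖ ^ 2) by positivity]
  · rw [Set.indicator_of_notMem (by simpa using h), min_eq_right (le_of_not_ge h),
      min_eq_right (by nlinarith)]
    linarith [sq ‖u‖]

theorem levyKhintchineExponent_zero (b : EuclideanSpace ℝ (Fin d))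
    (ν : Measure (EuclideanSpace ℝ (Fin d))) (ξ : EuclideanSpace ℝ (Fin d)) :
    levyKhintchineExponent b 0 ν ξ = purelyNonGaussianExponent b ν ξ := by
  simp [levyKhintchineExponent, purelyNonGaussianExponent, compensatedExp]

end Levy

/-! ### The characterization for random vectors -/

theorem mainTheorem1 {d : ℕ} {Ω : Type*} [MeasurableSpace Ω]
    (P : Measure Ω) [IsProbabilityMeasure P]
    (X : Ω → EuclideanSpace ℝ (Fin d)) (hX : AEMeasurable X P)
    (hX1 : ∀ i, Integrable (fun ω => X ω i) P)
    (ν : Measure (EuclideanSpace ℝ (Fin d))) (hν : IsLevyMeasure ν)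
    (hν1 : ∫⁻ u in {u | 1 ≤ ‖u‖}, ‖u‖ₑ ∂ν < ∞) :
    ((∀ f : EuclideanSpace ℝ (Fin d) → ℝ,
        (∃ M : ℝ, ∀ x, |f x| ≤ M) → (∃ K : ℝ≥0, LipschitzWith K f) →
        ∫ ω, f (X ω) • X ω ∂P
          = (∫ ω, f (X ω) ∂P) • (∫ ω, X ω ∂P)
            + ∫ ω, (∫ u, (f (X ω + u) - f (X ω)) • u ∂ν) ∂P)
      ↔ ∃ b : EuclideanSpace ℝ (Fin d), IsIDWithTriplet (P.map X) b 0 ν)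
    ∧ ∀ b : EuclideanSpace ℝ (Fin d), IsIDWithTriplet (P.map X) b 0 ν →
        b = ∫ ω, X ω ∂P - ∫ u in {u | 1 < ‖u‖}, u ∂ν := by
  have : SFinite ν := hν.sFinite
  have hw := hν.integrable_min_one_norm_mul_norm hν1
  have : IsProbabilityMeasure (P.map X) := Measure.isProbabilityMeasure_map hX
  have hXi : Integrable X P := Integrable.of_eval_piLp hX1
  have hμ : Integrable (fun x => x) (P.map X) :=
    (integrable_map_measure continuous_id.aestronglyMeasurable hX).2 hXi
  have hmean : ∫ ω, X ω ∂P = ∫ x, x ∂(P.map X) :=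
    (integral_map hX continuous_id.aestronglyMeasurable).symm
  -- Both sides depend on X only through its law, so the identity on Ω is transferred to the image
  -- measure.
  have hlaw : ∀ (C : ℝ) (f : EuclideanSpace ℝ (Fin d) → ℝ),
      IsBoundedLipschitz C (fun x => (f x : ℂ)) →
      ((∀ η, SteinIdentity (P.map X) ν (∫ ω, X ω ∂P) η (fun x => (f x : ℂ))) ↔
        ∫ ω, f (X ω) • X ω ∂P = (∫ ω, f (X ω) ∂P) • (∫ ω, X ω ∂P)
          + ∫ ω, (∫ u, (f (X ω + u) - f (X ω)) • u ∂ν) ∂P) := fun C f hf => by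
    have hc := hf.lipschitzWith.continuous
    rw [hmean, forall_steinIdentity_ofReal_iff hμ hw hf,
      integral_map hX (f := fun x => f x • x) (by fun_prop),
      integral_map hX (f := f) (by fun_prop),
      integral_map hX (f := fun x => ∫ u, (f (x + u) - f x) • u ∂ν)
        (hf.integrable_increment_smul hw).integral_prod_left.aestronglyMeasurable]
  have hchar : ∀ b, IsIDWithTriplet (P.map X) b 0 ν →
      ∀ ξ, charFun (P.map X) ξ = Complex.exp (purelyNonGaussianExponent b ν ξ) := fun b hb ξ => by
    rw [hb.charFun_eq, levyKhintchineExponent_zero]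
  refine ⟨⟨fun h => ?_, fun ⟨b, hb⟩ f ⟨M, hM⟩ ⟨K, hK⟩ => ?_⟩, fun b hb => ?_⟩
  -- This drift is forced: it makes the η-derivative of the exponent at 0 equal to i⟨η, E X⟩.
  · refine ⟨∫ ω, X ω ∂P - ∫ u in {u | 1 < ‖u‖}, u ∂ν, .zero, hν, fun ξ => ?_⟩
    rw [levyKhintchineExponent_zero]
    have hreal : ∀ (C : ℝ) (f : EuclideanSpace ℝ (Fin d) → ℝ),
        IsBoundedLipschitz C (fun x => (f x : ℂ)) →
        ∀ η, SteinIdentity (P.map X) ν (∫ ω, X ω ∂P) η (fun x => (f x : ℂ)) := fun C f hf =>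
      (hlaw C f hf).2 (h f
        ⟨C, fun x => by simpa [Complex.norm_real] using hf.norm_le x⟩ ⟨_, hf.lipschitzWith⟩)
    refine charFun_eq_of_steinIdentity_exp hμ hw (fun ζ η => ?_) ξ
    have hexp := isBoundedLipschitz_exp ζ
    exact SteinIdentity.of_re_im hμ hw hexp (hreal _ _ hexp.re η) (hreal _ _ hexp.im η)
  · have hf := IsBoundedLipschitz.of_lipschitzWith hM hK
    refine (hlaw _ f hf).1 fun η => ?_
    rw [hmean]
    exact SteinIdentity.of_isBoundedLipschitz hμ hw hf fun ξ =>
      steinIdentity_exp_of_charFun_eq hμ hw (hchar b hb) ξ η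
  · rw [hmean, integral_id_eq_of_charFun_eq hμ hw (hchar b hb), add_sub_cancel_right]
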